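/- Let $\mathbb T$ be the unit circle with normalised arc length and let $L^2=L^2(\mathbb T)$, $L^\infty=L^\infty(\mathbb T)$. Let $H^2_+\subset L^2$ be the Hardy space of functions whose Fourier coefficients of negative index vanish, $H^2_-=(H^2_+)^\perp$ the space of functions whose Fourier coefficients of nonnegative index vanish, and $P^\pm$ the orthogonal projections of $L^2$ onto $H^2_\pm$. A function is inner if it lies in $H^\infty=L^\infty\cap H^2_+$ and has modulus $1$ a.e. on $\mathbb T$. A function $f\in H^2_+$ is outer in $H^2_+$ if $\{pf : p \text{ a polynomial in } z\}$ is dense in $H^2_+$, and $f\in H^2_-$ is outer in $H^2_-$ if $\bar z\bar f$ is outer in $H^2_+$. Let $a,b\in L^\infty$ with $a\neq 0$ and $b\neq 0$ a.e. on $\mathbb T$, and let $\Sigma_{a,b}=P^+aI+P^-bI$, that is, $\Sigma_{a,b}f=P^+(af)+P^-(bf)$ for $f\in L^2$ (the transposed paired operator). Then $\ker\Sigma_{a,b}\neq\{0\}$ if and only if there exist $I_-,O_-,O_+$ such that $\overline{I_-}$ is inner, $O_\pm\in H^2_\pm$ are outer in $H^2_\pm$, and $$\frac ab=I_-O_-O_+^{-1}\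 \text{ a.e. on }\mathbb T,\qquad \frac{O_-}{a},\ \frac{O_+}{b}\in L^2 .$$ Moreover, for any such $I_-,O_-,O_+$, the function $O_+/b$ is a nonzero element of $\ker\Sigma_{a,b}$. -/

import Mathlib

open MeasureTheory AddCircle
open scoped ENNReal ComplexConjugate Real

noncomputable section

namespace PairedOp

instance fact_two_pi_pos : Fact (0 < 2 * π) := ⟨Real.two_pi_pos⟩

/-- The unit circle, in the coordinate `x ↦ exp (i x)`, so that `fourier n` is `z ^ n`. -/
abbrev 𝕋 : Type := AddCircle (2 * π)

/-- Normalised arc length on the circle. -/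
abbrev arc : Measure 𝕋 := haarAddCircle

abbrev L2 : Type := Lp ℂ 2 arc

abbrev Linf : Type := Lp ℂ ∞ arc

/-- The functions in `L²` all of whose Fourier coefficients with index in `s` vanish. -/
def coeffVanish (s : Set ℤ) : Submodule ℂ L2 where
  carrier := {f | ∀ n ∈ s, fourierCoeff (f : 𝕋 → ℂ) n = 0}
  zero_mem' := fun n _ => by
    rw [← fourierBasis_repr]; simp
  add_mem' := fun {f g} hf hg n hn => by
    have h1 := hf n hn
    have h2 := hg n hn
    rw [← fourierBasis_repr] at h1 h2 ⊢
    simp [h1, h2]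
  smul_mem' := fun c f hf n hn => by
    have h1 := hf n hn
    rw [← fourierBasis_repr] at h1 ⊢
    simp [h1]

theorem isClosed_coeffVanish (s : Set ℤ) : IsClosed (coeffVanish s : Set L2) := by
  have h : (coeffVanish s : Set L2) =
      ⋂ n ∈ s, {f : L2 | inner ℂ (fourierBasis (T := 2 * π) n) f = 0} := by
    ext f
    simp only [Set.mem_iInter, Set.mem_ofPred_eq, ← HilbertBasis.repr_apply_apply,
      fourierBasis_repr]
    rfl
  rw [h]
  exact isClosed_biInter fun n _ =>
    isClosed_eq (continuous_const.inner continuous_id) continuous_const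

instance (s : Set ℤ) : CompleteSpace (coeffVanish s) :=
  (isClosed_coeffVanish s).completeSpace_coe

/-- The Hardy space `H²₊`: Fourier coefficients vanish at all negative indices. -/
abbrev H2plus : Submodule ℂ L2 := coeffVanish {n | n < 0}

/-- The space `H²₋`, the orthogonal complement of `H²₊` in `L²`: Fourier coefficients vanish at
all nonnegative indices. -/
abbrev H2minus : Submodule ℂ L2 := coeffVanish {n | 0 ≤ n}

/-- The orthogonal projection `P⁺` of `L²` onto `H²₊`. -/
def Pplus : L2 →L[ℂ] L2 := H2plus.starProjection

/-- The orthogonal projection `P⁻` of `L²` onto `H²₋`. -/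
def Pminus : L2 →L[ℂ] L2 := H2minus.starProjection

/-- Multiplication on `L²` by a function in `L^∞`. -/
def mulOp (a : Linf) : L2 →L[ℂ] L2 :=
  (ContinuousLinearMap.mul ℂ ℂ).holderL arc ∞ 2 2 a

theorem coeFn_mulOp (a : Linf) (f : L2) : mulOp a f =ᵐ[arc] fun x => a x * f x :=
  (ContinuousLinearMap.mul ℂ ℂ).coeFn_holder a f

/-- The transposed paired operator `Σ_{a,b} = P⁺ a I + P⁻ b I` on `L²`. -/
def transposedPaired (a b : Linf) : L2 →L[ℂ] L2 :=
  Pplus ∘L mulOp a + Pminus ∘L mulOp b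

/-- The function `z ^ n` as an element of `L^∞`. -/
abbrev zpowInf (n : ℤ) : Linf := fourierLp ∞ n

/-- `θ` is inner: it belongs to `H^∞` and is unimodular almost everywhere on the circle. -/
def IsInner (θ : Linf) : Prop :=
  (∀ n : ℤ, n < 0 → fourierCoeff (θ : 𝕋 → ℂ) n = 0) ∧ ∀ᵐ x ∂arc, ‖θ x‖ = 1

/-- `f` is outer in `H²₊`: it belongs to `H²₊` and is cyclic for multiplication by `z`, that is,
the functions `p f` with `p` a polynomial in `z` are dense in `H²₊`. -/
def IsOuterPlus (f : L2) : Prop :=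
  f ∈ H2plus ∧
    (Submodule.span ℂ (Set.range fun n : ℕ => mulOp (zpowInf n) f)).topologicalClosure = H2plus

/-- `f` is outer in `H²₋`: it belongs to `H²₋` and the product of the complex conjugates of `z` and
of `f` is outer in `H²₊`. -/
def IsOuterMinus (f : L2) : Prop :=
  f ∈ H2minus ∧ IsOuterPlus (mulOp (zpowInf (-1)) (star f))

/-- The factorisation `a / b = I₋ O₋ O₊⁻¹` almost everywhere on the circle, where the complex
conjugate of `I₋` is inner, `O₋` and `O₊` are outer in `H²₋` and `H²₊`, and both `O₋ / a` and
`O₊ / b` belong to `L²`. -/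
def IsFactorization (a b Im : Linf) (Om Op : L2) : Prop :=
  IsInner (star Im) ∧ IsOuterMinus Om ∧ IsOuterPlus Op ∧
    (∀ᵐ x ∂arc, a x / b x = Im x * Om x * (Op x)⁻¹) ∧
    MemLp (fun x => Om x / a x) 2 arc ∧ MemLp (fun x => Op x / b x) 2 arc

end PairedOp

end

namespace PairedOp

/-! The ranges of `P⁺` and `P⁻` meet only in 0, so `f` is in the kernel iff `af ∈ H²₋` and `bf ∈
H²₊`. For such `f ≠ 0`, inner-outer factorisation gives `af = J̄ O₋` and `bf = I O₊`; dividing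
yields `a/b = conj (JI) O₋ O₊⁻¹`, and `|O₋/a| = |f| = |O₊/b|` gives integrability. Conversely `φ =
O₊/b` has `bφ = O₊ ∈ H²₊` and `aφ = I₋ O₋ ∈ H²₋`.

The factorisation comes from Beurling's argument (`exists_wandering_vector`, `exists_inner_outer`):
in the cyclic space `E` of `g`, a unit vector orthogonal to `zE` is unimodular, and dividing `g` by
it leaves an outer function. The map `f ↦ z̄ f̄` carries this over to `H²₋`. -/

/-! ### Multiplication, conjugation and Fourier coefficients -/

theorem fourierCoeff_eq_inner (f : L2) (n : ℤ) :
    fourierCoeff (f : 𝕋 → ℂ) n = inner ℂ (fourierLp 2 n : L2) f := by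
  rw [← fourierBasis_repr, HilbertBasis.repr_apply_apply, coe_fourierBasis]

theorem eq_zero_of_fourierCoeff (f : L2) (h : ∀ n, fourierCoeff (f : 𝕋 → ℂ) n = 0) : f = 0 := by
  apply fourierBasis.repr.injective
  ext n
  rw [fourierBasis_repr, h n]
  simp

theorem coeFn_star_ae {p : ℝ≥0∞} (f : Lp ℂ p arc) : ∀ᵐ x ∂arc, star f x = conj (f x) := by
  filter_upwards [Lp.coeFn_star f] with x hx
  rw [hx]; rfl

theorem coeFn_zpow_ae (p : ℝ≥0∞) [Fact (1 ≤ p)] (n : ℤ) :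
    ∀ᵐ x ∂arc, (fourierLp p n : Lp ℂ p arc) x = fourier n x := coeFn_fourierLp p n

theorem norm_fourier_apply (n : ℤ) (x : 𝕋) : ‖fourier n x‖ = 1 :=
  Circle.norm_coe _

theorem mulOp_mulOp_comm (a b : Linf) (f : L2) : mulOp a (mulOp b f) = mulOp b (mulOp a f) := by
  apply Lp.ext
  filter_upwards [coeFn_mulOp a (mulOp b f), coeFn_mulOp b f, coeFn_mulOp b (mulOp a f),
    coeFn_mulOp a f] with x h1 h2 h3 h4
  rw [h1, h2, h3, h4]; ring

theorem mulOp_zpow_add (m n : ℤ) (f : L2) :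
    mulOp (zpowInf m) (mulOp (zpowInf n) f) = mulOp (zpowInf (m + n)) f := by
  apply Lp.ext
  filter_upwards [coeFn_mulOp (zpowInf m) (mulOp (zpowInf n) f), coeFn_mulOp (zpowInf n) f,
    coeFn_mulOp (zpowInf (m + n)) f, coeFn_zpow_ae ∞ m, coeFn_zpow_ae ∞ n,
    coeFn_zpow_ae ∞ (m + n)] with x h1 h2 h3 h4 h5 h6
  rw [h1, h2, h3, h4, h5, h6, fourier_add]; ring

theorem mulOp_zpow_zero (f : L2) : mulOp (zpowInf 0) f = f := by
  apply Lp.ext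
  filter_upwards [coeFn_mulOp (zpowInf 0) f, coeFn_zpow_ae ∞ 0] with x h1 h2
  rw [h1, h2, fourier_zero, one_mul]

theorem mulOp_zpow_fourierLp (m n : ℤ) :
    mulOp (zpowInf m) (fourierLp 2 n : L2) = fourierLp 2 (m + n) := by
  apply Lp.ext
  filter_upwards [coeFn_mulOp (zpowInf m) (fourierLp 2 n : L2), coeFn_zpow_ae ∞ m,
    coeFn_zpow_ae 2 n, coeFn_zpow_ae 2 (m + n)] with x h1 h2 h3 h4
  rw [h1, h2, h3, h4, fourier_add]

theorem star_zpowInf (n : ℤ) : star (zpowInf n) = zpowInf (-n) := by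
  apply Lp.ext
  filter_upwards [coeFn_star_ae (zpowInf n), coeFn_zpow_ae ∞ n, coeFn_zpow_ae ∞ (-n)]
    with x h1 h2 h3
  rw [h1, h2, h3, fourier_neg]

theorem inner_mulOp_right (a : Linf) (f g : L2) :
    inner ℂ f (mulOp a g) = inner ℂ (mulOp (star a) f) g := by
  rw [L2.inner_def, L2.inner_def]
  apply integral_congr_ae
  filter_upwards [coeFn_mulOp a g, coeFn_mulOp (star a) f, coeFn_star_ae a] with x h1 h2 h3
  simp only [RCLike.inner_apply, h1, h2, h3, map_mul, Complex.conj_conj]; ring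

theorem inner_mulOp_zpow_right (n : ℤ) (f g : L2) :
    inner ℂ f (mulOp (zpowInf n) g) = inner ℂ (mulOp (zpowInf (-n)) f) g := by
  rw [inner_mulOp_right, star_zpowInf]

theorem fourierCoeff_mulOp_zpow (m n : ℤ) (f : L2) :
    fourierCoeff (mulOp (zpowInf m) f : 𝕋 → ℂ) n = fourierCoeff (f : 𝕋 → ℂ) (n - m) := by
  rw [fourierCoeff_eq_inner, fourierCoeff_eq_inner, inner_mulOp_zpow_right, mulOp_zpow_fourierLp,
    neg_add_eq_sub]

theorem fourierCoeff_star (f : L2) (n : ℤ) :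
    fourierCoeff (star f : L2) n = conj (fourierCoeff (f : 𝕋 → ℂ) (-n)) := by
  rw [fourierCoeff, fourierCoeff, ← integral_conj]
  apply integral_congr_ae
  filter_upwards [coeFn_star_ae f] with x hx
  rw [hx, fourier_neg, neg_neg, smul_eq_mul, smul_eq_mul, map_mul]

/-! ### Cyclic subspaces and inner multipliers -/

/-- The closed span of the functions `z ^ n f` with `n` a natural number. -/
noncomputable abbrev cyclicSpan (f : L2) : Submodule ℂ L2 :=
  (Submodule.span ℂ (Set.range fun n : ℕ => mulOp (zpowInf n) f)).topologicalClosure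

theorem mulOp_mem_cyclicSpan (f : L2) (n : ℕ) : mulOp (zpowInf n) f ∈ cyclicSpan f :=
  Submodule.le_topologicalClosure _ (Submodule.subset_span ⟨n, rfl⟩)

theorem self_mem_cyclicSpan (f : L2) : f ∈ cyclicSpan f := by
  simpa [mulOp_zpow_zero] using mulOp_mem_cyclicSpan f 0

theorem map_cyclicSpan_mem (A : L2 →L[ℂ] L2) (f : L2) {K : Submodule ℂ L2}
    (hK : IsClosed (K : Set L2)) (h : ∀ n : ℕ, A (mulOp (zpowInf n) f) ∈ K) {g : L2}
    (hg : g ∈ cyclicSpan f) : A g ∈ K := by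
  have h1 : cyclicSpan f ≤ K.comap (A : L2 →ₗ[ℂ] L2) := by
    apply Submodule.topologicalClosure_minimal
    · rw [Submodule.span_le]
      rintro _ ⟨n, rfl⟩
      exact h n
    · exact hK.preimage A.continuous
  exact h1 hg

theorem isClosed_cyclicSpan (f : L2) : IsClosed (cyclicSpan f : Set L2) :=
  Submodule.isClosed_topologicalClosure _

theorem cyclicSpan_le {f : L2} {K : Submodule ℂ L2} (hK : IsClosed (K : Set L2))
    (h : ∀ n : ℕ, mulOp (zpowInf n) f ∈ K) : cyclicSpan f ≤ K := fun _ hg =>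
  map_cyclicSpan_mem (ContinuousLinearMap.id ℂ L2) f hK h hg

theorem mulOp_zpow_mem_H2plus {f : L2} (hf : f ∈ H2plus) (n : ℕ) :
    mulOp (zpowInf n) f ∈ H2plus := fun k hk => by
  rw [fourierCoeff_mulOp_zpow]
  apply hf
  simp only [Set.mem_ofPred_eq] at hk ⊢
  omega

theorem cyclicSpan_le_H2plus {f : L2} (hf : f ∈ H2plus) : cyclicSpan f ≤ H2plus :=
  cyclicSpan_le (isClosed_coeffVanish _) (mulOp_zpow_mem_H2plus hf)

theorem H2plus_le {K : Submodule ℂ L2} (hK : IsClosed (K : Set L2))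
    (h : ∀ n : ℕ, (fourierLp 2 n : L2) ∈ K) : H2plus ≤ K := fun f hf => by
  have hs := hasSum_fourier_series_L2 f
  apply hK.mem_of_tendsto hs
  refine Filter.Eventually.of_forall fun s => K.sum_mem fun n _ => ?_
  rcases lt_or_ge n 0 with hn | hn
  · rw [hf n hn, zero_smul]; exact K.zero_mem
  · lift n to ℕ using hn
    exact K.smul_mem _ (h n)

theorem isInner_mulOp_mem_H2plus {θ : Linf} (hθ : IsInner θ) {f : L2} (hf : f ∈ H2plus) :
    mulOp θ f ∈ H2plus := by
  have h1 : H2plus ≤ H2plus.comap (mulOp θ : L2 →ₗ[ℂ] L2) := by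
    apply H2plus_le ((isClosed_coeffVanish _).preimage (mulOp θ).continuous)
    intro k n hn
    have h2 : fourierCoeff (mulOp θ (fourierLp 2 k : L2) : 𝕋 → ℂ) n
        = fourierCoeff (θ : 𝕋 → ℂ) (n - k) := by
      apply integral_congr_ae
      filter_upwards [coeFn_mulOp θ (fourierLp 2 k : L2), coeFn_zpow_ae 2 (k : ℤ)] with x h1 h2
      rw [h1, h2, neg_sub, sub_eq_add_neg, fourier_add, smul_eq_mul, smul_eq_mul]; ring
    change fourierCoeff (mulOp θ (fourierLp 2 k : L2) : 𝕋 → ℂ) n = 0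
    rw [h2]
    apply hθ.1
    simp only [Set.mem_ofPred_eq] at hn
    omega
  exact h1 hf

theorem exists_Linf_of_norm_eq_one (h : L2) (hh : ∀ᵐ x ∂arc, ‖h x‖ = 1) :
    ∃ θ : Linf, θ =ᵐ[arc] h := by
  have hm : MemLp h ∞ arc :=
    memLp_top_of_bound (Lp.aestronglyMeasurable h) 1 (hh.mono fun x hx => hx.le)
  exact ⟨hm.toLp h, hm.coeFn_toLp⟩

theorem exists_isInner_of_mem_H2plus {h : L2} (hp : h ∈ H2plus) (hh : ∀ᵐ x ∂arc, ‖h x‖ = 1) :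
    ∃ θ : Linf, IsInner θ ∧ θ =ᵐ[arc] h := by
  obtain ⟨θ, hθ⟩ := exists_Linf_of_norm_eq_one h hh
  refine ⟨θ, ⟨fun n hn => ?_, ?_⟩, hθ⟩
  · rw [fourierCoeff_congr_ae hθ]; exact hp n hn
  · filter_upwards [hθ, hh] with x h1 h2
    rw [h1, h2]

theorem fourierLp_mem_H2plus (k : ℕ) : (fourierLp 2 k : L2) ∈ H2plus := fun n hn => by
  rw [fourierCoeff_eq_inner, orthonormal_iff_ite.1 orthonormal_fourier, if_neg]
  simp only [Set.mem_ofPred_eq] at hn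
  omega

/-- Inner functions multiply `H²₊` into itself, so applying both to the constant 1 stays in `H²₊`.
-/
theorem exists_isInner_mul {θ ψ : Linf} (hθ : IsInner θ) (hψ : IsInner ψ) :
    ∃ ω : Linf, IsInner ω ∧ ∀ᵐ x ∂arc, ω x = θ x * ψ x := by
  have h0 : (fourierLp 2 0 : L2) ∈ H2plus := fourierLp_mem_H2plus 0
  have h1 : ∀ᵐ x ∂arc, mulOp θ (mulOp ψ (fourierLp 2 0 : L2)) x = θ x * ψ x := by
    filter_upwards [coeFn_mulOp θ (mulOp ψ (fourierLp 2 0 : L2)),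
      coeFn_mulOp ψ (fourierLp 2 0 : L2), coeFn_zpow_ae 2 0] with x h1 h2 h3
    rw [h1, h2, h3, fourier_zero, mul_one]
  obtain ⟨ω, hω, h2⟩ := exists_isInner_of_mem_H2plus
    (isInner_mulOp_mem_H2plus hθ (isInner_mulOp_mem_H2plus hψ h0)) (by
      filter_upwards [h1, hθ.2, hψ.2] with x h1 h2 h3
      rw [h1, norm_mul, h2, h3, one_mul])
  exact ⟨ω, hω, h2.trans h1⟩


/-! ### Beurling's theorem for cyclic subspaces -/

/-- The hypotheses, with conjugate symmetry, say that `|φ|²` has the Fourier coefficients of 1. Both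
sides are continuous in `c` and agree on the `z ^ n`, whose span is dense in `C(𝕋, ℂ)`. -/
theorem inner_mulOp_toLp_self (φ : L2) (hφ : ‖φ‖ = 1)
    (h : ∀ n : ℕ, 0 < n → inner ℂ φ (mulOp (zpowInf n) φ) = 0) (c : C(𝕋, ℂ)) :
    inner ℂ φ (mulOp (ContinuousMap.toLp ∞ arc ℂ c) φ) = ∫ x, c x ∂arc := by
  have hz : ∀ n : ℤ, inner ℂ φ (mulOp (zpowInf n) φ) = if n = 0 then 1 else 0 := by
    intro n
    rcases lt_trichotomy n 0 with hn | rfl | hn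
    · lift -n to ℕ using by omega with m hm
      rw [inner_mulOp_zpow_right, ← inner_conj_symm, ← hm, h m (by omega), map_zero, if_neg hn.ne]
    · rw [mulOp_zpow_zero, inner_self_eq_norm_sq_to_K, hφ]; simp
    · lift n to ℕ using hn.le
      rw [h n (by omega), if_neg hn.ne']
  let A : C(𝕋, ℂ) →L[ℂ] ℂ := (innerSL ℂ φ) ∘L
    (((ContinuousLinearMap.mul ℂ ℂ).holderL arc ∞ 2 2).flip φ) ∘L (ContinuousMap.toLp ∞ arc ℂ)
  let B : C(𝕋, ℂ) →L[ℂ] ℂ := (innerSL ℂ (fourierLp 2 0 : L2)) ∘L (ContinuousMap.toLp 2 arc ℂ)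
  have hB : ∀ c, B c = ∫ x, c x ∂arc := by
    intro c
    change inner ℂ (fourierLp 2 0 : L2) (ContinuousMap.toLp 2 arc ℂ c) = _
    rw [L2.inner_def]
    apply integral_congr_ae
    filter_upwards [coeFn_zpow_ae 2 0, ContinuousMap.coeFn_toLp (p := 2) (𝕜 := ℂ) arc c]
      with x h1 h2
    rw [h1, h2, RCLike.inner_apply, fourier_zero, map_one, mul_one]
  have hAB : A = B := by
    apply ContinuousLinearMap.ext_on (s := Set.range (@fourier (2 * π)))
    · exact Submodule.dense_iff_topologicalClosure_eq_top.2 span_fourier_closure_eq_top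
    · rintro _ ⟨n, rfl⟩
      refine (hz n).trans ?_
      change _ = inner ℂ (fourierLp 2 0 : L2) (fourierLp 2 n : L2)
      rw [orthonormal_iff_ite.1 orthonormal_fourier]
      simp only [eq_comm]
  rw [← hB, ← hAB]
  rfl

/-- The finite measures `|φ|² dm` and `dm` integrate continuous functions alike, so they coincide
and their densities agree a.e. -/
theorem norm_eq_one_of_inner_mulOp (φ : L2) (hφ : ‖φ‖ = 1)
    (h : ∀ n : ℕ, 0 < n → inner ℂ φ (mulOp (zpowInf n) φ) = 0) : ∀ᵐ x ∂arc, ‖φ x‖ = 1 := by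
  have hm : AEMeasurable (fun x => ‖φ x‖₊ ^ 2) arc :=
    ((Lp.aestronglyMeasurable φ).aemeasurable.nnnorm).pow_const 2
  have hfin : ∫⁻ x, ((‖φ x‖₊ ^ 2 : NNReal) : ℝ≥0∞) ∂arc ≠ ∞ := by
    have h2 := (Lp.memLp φ).integrable_norm_pow (by norm_num : (2 : ℕ) ≠ 0)
    have h3 := h2.hasFiniteIntegral
    rw [HasFiniteIntegral] at h3
    refine (lt_of_le_of_lt (le_of_eq ?_) h3).ne
    congr 1; ext x
    simp [enorm_eq_nnnorm]
  have : IsFiniteMeasure (arc.withDensity fun x => ((‖φ x‖₊ ^ 2 : NNReal) : ℝ≥0∞)) :=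
    isFiniteMeasure_withDensity hfin
  have hμ : arc.withDensity (fun x => ((‖φ x‖₊ ^ 2 : NNReal) : ℝ≥0∞)) = arc := by
    apply ext_of_forall_integral_eq_of_IsFiniteMeasure
    intro f
    rw [integral_withDensity_eq_integral_smul₀ hm]
    have h1 := inner_mulOp_toLp_self φ hφ h
      ⟨fun x => (f x : ℂ), Complex.continuous_ofReal.comp f.continuous⟩
    rw [L2.inner_def] at h1
    apply Complex.ofReal_injective
    rw [← integral_complex_ofReal, ← integral_complex_ofReal]
    refine Eq.trans ?_ h1
    apply integral_congr_ae
    filter_upwards [coeFn_mulOp (ContinuousMap.toLp ∞ arc ℂ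
      ⟨fun x => (f x : ℂ), Complex.continuous_ofReal.comp f.continuous⟩) φ,
      ContinuousMap.coeFn_toLp (p := ∞) (𝕜 := ℂ) arc
      ⟨fun x => (f x : ℂ), Complex.continuous_ofReal.comp f.continuous⟩] with x h1 h2
    rw [h1, h2, RCLike.inner_apply, mul_assoc, RCLike.mul_conj, NNReal.smul_def, smul_eq_mul]
    simp [mul_comm]
  have h4 : arc.withDensity (fun x => ((‖φ x‖₊ ^ 2 : NNReal) : ℝ≥0∞)) = arc.withDensity fun _ => 1 := by
    rw [hμ]; exact withDensity_one.symm
  rw [withDensity_eq_iff hm.coe_nnreal_ennreal aemeasurable_const hfin] at h4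
  filter_upwards [h4] with x hx
  have hx1 : ‖φ x‖₊ ^ 2 = 1 := by exact_mod_cast hx
  rw [← coe_nnnorm, (pow_eq_one_iff_of_nonneg zero_le two_ne_zero).1 hx1, NNReal.coe_one]

theorem mulOp_zpow_mem_cyclicSpan_shift (g : L2) {n : ℕ} (hn : 0 < n) {f : L2}
    (hf : f ∈ cyclicSpan g) : mulOp (zpowInf n) f ∈ cyclicSpan (mulOp (zpowInf 1) g) := by
  apply map_cyclicSpan_mem _ _ (isClosed_cyclicSpan _) _ hf
  intro k
  obtain ⟨m, rfl⟩ := Nat.exists_eq_add_of_lt hn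
  convert mulOp_mem_cyclicSpan (mulOp (zpowInf 1) g) (m + k) using 1
  rw [mulOp_zpow_add, mulOp_zpow_add]
  congr 3
  push_cast
  ring

/-- Otherwise the cyclic space of `g` would be stable under `z̄`, so every `z̄ ^ k g` would lie in
`H²₊`, which forces `g = 0`. -/
theorem not_mem_cyclicSpan_shift {g : L2} (hg : g ∈ H2plus) (h0 : g ≠ 0) :
    g ∉ cyclicSpan (mulOp (zpowInf 1) g) := by
  intro h
  have h1 : cyclicSpan g ≤ cyclicSpan (mulOp (zpowInf 1) g) := by
    apply cyclicSpan_le (isClosed_cyclicSpan _)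
    intro n
    rcases Nat.eq_zero_or_pos n with rfl | hn
    · simpa [mulOp_zpow_zero] using h
    · exact mulOp_zpow_mem_cyclicSpan_shift g hn (self_mem_cyclicSpan g)
  have h2 : ∀ f ∈ cyclicSpan g, mulOp (zpowInf (-1)) f ∈ cyclicSpan g := by
    intro f hf
    apply map_cyclicSpan_mem _ _ (isClosed_cyclicSpan _) _ (h1 hf)
    intro n
    rw [mulOp_zpow_add, mulOp_zpow_add, show (-1 + (n : ℤ) + 1) = n by ring]
    exact mulOp_mem_cyclicSpan g n
  have h3 : ∀ k : ℕ, mulOp (zpowInf (-k)) g ∈ cyclicSpan g := by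
    intro k
    induction k with
    | zero => simpa [mulOp_zpow_zero] using self_mem_cyclicSpan g
    | succ k ih =>
      convert h2 _ ih using 1
      rw [mulOp_zpow_add]
      congr 3
      push_cast; ring
  apply h0
  apply eq_zero_of_fourierCoeff
  intro n
  have h4 := cyclicSpan_le_H2plus hg (h3 (n.natAbs + 1)) (n - (n.natAbs + 1 : ℕ))
    (by simp only [Set.mem_ofPred_eq]; omega)
  rw [fourierCoeff_mulOp_zpow] at h4
  convert h4 using 2
  ring

/-- The generator in Beurling's theorem for the cyclic subspace of `g`. -/
theorem exists_wandering_vector {g : L2} (hg : g ∈ H2plus) (h0 : g ≠ 0) :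
    ∃ φ ∈ cyclicSpan g, (∀ᵐ x ∂arc, ‖φ x‖ = 1) ∧
      ∀ f ∈ cyclicSpan g, ∀ n : ℕ, 0 < n → inner ℂ φ (mulOp (zpowInf n) f) = 0 := by
  set K := cyclicSpan (mulOp (zpowInf 1) g) with hK
  have : CompleteSpace K := (isClosed_cyclicSpan _).completeSpace_coe
  have hKle : K ≤ cyclicSpan g := by
    apply cyclicSpan_le (isClosed_cyclicSpan _)
    intro n
    rw [mulOp_zpow_add]
    exact_mod_cast mulOp_mem_cyclicSpan g (n + 1)
  -- `K` is `z` times the cyclic space; it contains every `z ^ n f` with `n > 0`, so `ψ` is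
  -- orthogonal to all of these.
  set ψ := g - K.starProjection g with hψ
  have hψ0 : ψ ≠ 0 := by
    intro h
    apply not_mem_cyclicSpan_shift hg h0
    have h2 := K.starProjection_apply_mem g
    rwa [← sub_eq_zero.1 h] at h2
  have hψE : ψ ∈ cyclicSpan g :=
    Submodule.sub_mem _ (self_mem_cyclicSpan g) (hKle (K.starProjection_apply_mem g))
  set φ : L2 := ((‖ψ‖⁻¹ : ℝ) : ℂ) • ψ with hφ
  have hφE : φ ∈ cyclicSpan g := Submodule.smul_mem _ _ hψE
  have horth : ∀ f ∈ cyclicSpan g, ∀ n : ℕ, 0 < n → inner ℂ φ (mulOp (zpowInf n) f) = 0 := by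
    intro f hf n hn
    rw [hφ, inner_smul_left, Submodule.starProjection_inner_eq_zero _ _
      (mulOp_zpow_mem_cyclicSpan_shift g hn hf), mul_zero]
  refine ⟨φ, hφE, norm_eq_one_of_inner_mulOp φ ?_ (horth φ hφE), horth⟩
  rw [hφ, norm_smul, Complex.norm_real, norm_inv, norm_norm, inv_mul_cancel₀]
  exact norm_ne_zero_iff.2 hψ0

/-- The wandering vector is a limit of functions `p g`, so it vanishes wherever `g` does; yet it is
unimodular. -/
theorem ae_ne_zero_of_mem_H2plus {g : L2} (hg : g ∈ H2plus) (h0 : g ≠ 0) :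
    ∀ᵐ x ∂arc, g x ≠ 0 := by
  obtain ⟨φ, hφ, h1, -⟩ := exists_wandering_vector hg h0
  have hs : MeasurableSet {x | g x = 0} :=
    (Lp.stronglyMeasurable g).measurable (measurableSet_singleton 0)
  set χ : Linf := indicatorConstLp ∞ hs (measure_ne_top arc _) 1 with hχ
  have hc : ∀ᵐ x ∂arc, χ x = Set.indicator {x | g x = 0} (fun _ => (1 : ℂ)) x :=
    indicatorConstLp_coeFn
  have hg0 : mulOp χ g = 0 := by
    apply Lp.ext
    filter_upwards [coeFn_mulOp χ g, hc, Lp.coeFn_zero ℂ 2 arc] with x h1 h2 h3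
    rw [h1, h2, h3]
    by_cases hx : g x = 0 <;> simp [hx]
  have hφ0 : mulOp χ φ = 0 := by
    have : mulOp χ φ ∈ (⊥ : Submodule ℂ L2) := by
      apply map_cyclicSpan_mem _ g isClosed_singleton _ hφ
      intro n
      rw [mulOp_mulOp_comm, hg0, map_zero]
      exact Submodule.zero_mem _
    simpa using this
  rw [Lp.ext_iff] at hφ0
  filter_upwards [coeFn_mulOp χ φ, hc, hφ0, h1, Lp.coeFn_zero ℂ 2 arc] with x h2 h3 h4 h5 h6 hx
  rw [h2, h3, h6, Set.indicator_of_mem (by exact hx), one_mul] at h4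
  rw [h4] at h5
  simp at h5

/-- Inner-outer factorisation in `H²₊`. -/
theorem exists_inner_outer {g : L2} (hg : g ∈ H2plus) (h0 : g ≠ 0) :
    ∃ (θ : Linf) (O : L2), IsInner θ ∧ IsOuterPlus O ∧ g = mulOp θ O := by
  obtain ⟨φ, hφ, h1, horth⟩ := exists_wandering_vector hg h0
  obtain ⟨θ, hθ, hθφ⟩ := exists_isInner_of_mem_H2plus (cyclicSpan_le_H2plus hg hφ) h1
  have hφθ : ∀ n : ℤ, mulOp θ (fourierLp 2 n : L2) = mulOp (zpowInf n) φ := by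
    intro n
    apply Lp.ext
    filter_upwards [coeFn_mulOp θ (fourierLp 2 n : L2), coeFn_mulOp (zpowInf n) φ,
      coeFn_zpow_ae 2 n, coeFn_zpow_ae ∞ n, hθφ] with x h1 h2 h3 h4 h5
    rw [h1, h2, h3, h4, h5, mul_comm]
  have hinv : ∀ f : L2, mulOp (star θ) (mulOp θ f) = f := by
    intro f
    apply Lp.ext
    filter_upwards [coeFn_mulOp (star θ) (mulOp θ f), coeFn_mulOp θ f, coeFn_star_ae θ, hθ.2]
      with x h1 h2 h3 h4
    rw [h1, h2, h3, ← mul_assoc, RCLike.conj_mul, h4]; simp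
  -- The coefficient of `θ̄ f` at `-m` is `⟨φ, z ^ m f⟩`, which is zero for `m > 0`.
  have hmem : ∀ f ∈ cyclicSpan g, mulOp (star θ) f ∈ H2plus := by
    intro f hf n hn
    simp only [Set.mem_ofPred_eq] at hn
    obtain ⟨m, rfl⟩ : ∃ m : ℕ, n = -m := ⟨n.natAbs, by omega⟩
    rw [fourierCoeff_eq_inner, inner_mulOp_right, star_star, hφθ, ← inner_mulOp_zpow_right]
    exact horth f hf m (by omega)
  have hO : mulOp (star θ) g ∈ H2plus := hmem g (self_mem_cyclicSpan g)
  refine ⟨θ, mulOp (star θ) g, hθ, ⟨hO, le_antisymm (cyclicSpan_le_H2plus hO) ?_⟩, ?_⟩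
  · apply H2plus_le (isClosed_cyclicSpan _)
    intro k
    -- Here `z ^ k = z ^ k θ̄ φ`, and `φ` is a limit of functions `p g`, so `z ^ k` is a limit of
    -- functions `z ^ k p θ̄ g`.
    rw [← hinv (fourierLp 2 k : L2), hφθ, mulOp_mulOp_comm]
    have h2 : mulOp (star θ) φ ∈ cyclicSpan (mulOp (star θ) g) := by
      apply map_cyclicSpan_mem _ g (isClosed_cyclicSpan _) _ hφ
      intro n
      rw [mulOp_mulOp_comm]
      exact mulOp_mem_cyclicSpan _ n
    apply map_cyclicSpan_mem _ _ (isClosed_cyclicSpan _) _ h2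
    intro n
    rw [mulOp_zpow_add]
    exact_mod_cast mulOp_mem_cyclicSpan (mulOp (star θ) g) (k + n)
  · rw [mulOp_mulOp_comm, hinv]


theorem IsOuterPlus.ne_zero {f : L2} (h : IsOuterPlus f) : f ≠ 0 := by
  rintro rfl
  have h1 : (fourierLp 2 0 : L2) ∈ cyclicSpan 0 := by
    rw [cyclicSpan, h.2]; exact fourierLp_mem_H2plus 0
  have h2 : (fourierLp 2 0 : L2) ∈ (⊥ : Submodule ℂ L2) := by
    refine cyclicSpan_le isClosed_singleton (fun n => ?_) h1
    rw [map_zero]; exact Submodule.zero_mem _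
  exact orthonormal_fourier.ne_zero (0 : ℤ) (by simpa using h2)

/-! ### The kernel, and transfer to `H²₋` -/

theorem H2minus_eq_orthogonal : H2minus = H2plusᗮ := by
  ext f
  rw [Submodule.mem_orthogonal]
  constructor
  · intro hf g hg
    have h1 : H2plus ≤ (ℂ ∙ f)ᗮ := by
      apply H2plus_le (Submodule.isClosed_orthogonal _)
      intro k
      rw [Submodule.mem_orthogonal_singleton_iff_inner_left, ← fourierCoeff_eq_inner]
      exact hf k (by simp)
    exact Submodule.mem_orthogonal_singleton_iff_inner_left.1 (h1 hg)
  · intro h n hn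
    simp only [Set.mem_ofPred_eq] at hn
    lift n to ℕ using hn
    rw [fourierCoeff_eq_inner]
    exact h _ (fourierLp_mem_H2plus n)

theorem mem_ker_transposedPaired {a b : Linf} {f : L2} :
    f ∈ (transposedPaired a b).ker ↔ mulOp a f ∈ H2minus ∧ mulOp b f ∈ H2plus := by
  have hP : ∀ g : L2, Pplus g = 0 ↔ g ∈ H2minus := fun g => by
    rw [H2minus_eq_orthogonal]
    exact Submodule.starProjection_apply_eq_zero_iff H2plus
  have hM : ∀ g : L2, Pminus g = 0 ↔ g ∈ H2plus := fun g => by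
    have : H2plus = H2minusᗮ := by
      rw [H2minus_eq_orthogonal, Submodule.orthogonal_orthogonal]
    rw [this]
    exact Submodule.starProjection_apply_eq_zero_iff H2minus
  rw [← hP, ← hM]
  change Pplus (mulOp a f) + Pminus (mulOp b f) = 0 ↔ _
  constructor
  · intro h
    have h1 : Pplus (mulOp a f) ∈ H2plus := H2plus.starProjection_apply_mem _
    have h2 : Pminus (mulOp b f) ∈ H2minus := H2minus.starProjection_apply_mem _
    have h3 : Pplus (mulOp a f) = 0 := by
      apply eq_zero_of_fourierCoeff
      intro n
      rcases lt_or_ge n 0 with hn | hn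
      · exact h1 n hn
      · rw [eq_neg_of_add_eq_zero_left h]
        exact H2minus.neg_mem h2 n hn
    exact ⟨h3, by rwa [h3, zero_add] at h⟩
  · rintro ⟨h1, h2⟩
    rw [h1, h2, add_zero]

/-- The map `f ↦ \bar z \bar f`, which interchanges `H²₊` and `H²₋`. -/
noncomputable abbrev conjShift (f : L2) : L2 := mulOp (zpowInf (-1)) (star f)

theorem coeFn_conjShift (f : L2) :
    ∀ᵐ x ∂arc, conjShift f x = fourier (-1) x * conj (f x) := by
  filter_upwards [coeFn_mulOp (zpowInf (-1)) (star f), coeFn_zpow_ae ∞ (-1), coeFn_star_ae f]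
    with x h1 h2 h3
  rw [h1, h2, h3]

theorem conj_fourier_mul_self (n : ℤ) (x : 𝕋) : fourier n x * conj (fourier n x) = (1 : ℂ) := by
  rw [RCLike.mul_conj, norm_fourier_apply]; simp

theorem conjShift_conjShift (f : L2) : conjShift (conjShift f) = f := by
  apply Lp.ext
  filter_upwards [coeFn_conjShift f, coeFn_conjShift (conjShift f)] with x h1 h2
  rw [h2, h1, map_mul, Complex.conj_conj, ← mul_assoc, conj_fourier_mul_self, one_mul]

theorem fourierCoeff_conjShift (f : L2) (n : ℤ) :
    fourierCoeff (conjShift f : 𝕋 → ℂ) n = conj (fourierCoeff (f : 𝕋 → ℂ) (-(n + 1))) := by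
  rw [fourierCoeff_mulOp_zpow, fourierCoeff_star, sub_neg_eq_add]

theorem conjShift_mem_H2plus {f : L2} (hf : f ∈ H2minus) : conjShift f ∈ H2plus := fun n hn => by
  simp only [Set.mem_ofPred_eq] at hn
  rw [fourierCoeff_conjShift, hf _ (by simp only [Set.mem_ofPred_eq]; omega), map_zero]

theorem conjShift_mem_H2minus {f : L2} (hf : f ∈ H2plus) : conjShift f ∈ H2minus := fun n hn => by
  simp only [Set.mem_ofPred_eq] at hn
  rw [fourierCoeff_conjShift, hf _ (by simp only [Set.mem_ofPred_eq]; omega), map_zero]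

theorem conjShift_mulOp (θ : Linf) (f : L2) :
    conjShift (mulOp θ f) = mulOp (star θ) (conjShift f) := by
  apply Lp.ext
  filter_upwards [coeFn_conjShift (mulOp θ f), coeFn_conjShift f, coeFn_mulOp θ f,
    coeFn_mulOp (star θ) (conjShift f), coeFn_star_ae θ] with x h1 h2 h3 h4 h5
  rw [h1, h3, h4, h5, h2, map_mul]; ring

theorem mulOp_star_isInner_mem_H2minus {θ : Linf} (hθ : IsInner θ) {f : L2} (hf : f ∈ H2minus) :
    mulOp (star θ) f ∈ H2minus := by
  rw [← conjShift_conjShift f, ← conjShift_mulOp]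
  exact conjShift_mem_H2minus (isInner_mulOp_mem_H2plus hθ (conjShift_mem_H2plus hf))

/-- Inner-outer factorisation in `H²₋`. -/
theorem exists_inner_outer_minus {g : L2} (hg : g ∈ H2minus) (h0 : g ≠ 0) :
    ∃ (θ : Linf) (O : L2), IsInner θ ∧ IsOuterMinus O ∧ g = mulOp (star θ) O := by
  have h1 : conjShift g ≠ 0 := fun h => h0 <| by
    apply Lp.ext
    rw [Lp.ext_iff] at h
    filter_upwards [coeFn_conjShift g, h, Lp.coeFn_zero ℂ 2 arc] with x h1 h2 h3
    rw [h1, h3] at h2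
    have hz : (fourier (-1) x : ℂ) ≠ 0 := by
      rw [← norm_ne_zero_iff, norm_fourier_apply]; exact one_ne_zero
    rw [h3]
    exact (map_eq_zero _).1 ((mul_eq_zero.1 h2).resolve_left hz)
  obtain ⟨θ, U, hθ, hU, h⟩ := exists_inner_outer (conjShift_mem_H2plus hg) h1
  refine ⟨θ, conjShift U, hθ, ⟨conjShift_mem_H2minus hU.1, ?_⟩, ?_⟩
  · change IsOuterPlus (conjShift (conjShift U))
    rwa [conjShift_conjShift]
  · rw [← conjShift_mulOp, ← h, conjShift_conjShift]

/-! ### Kernel elements and factorisations -/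

theorem memLp_div_of_norm_eq {a : Linf} {f O : L2} (ha : ∀ᵐ x ∂arc, a x ≠ 0)
    (h : ∀ᵐ x ∂arc, ‖O x‖ = ‖a x * f x‖) : MemLp (fun x => O x / a x) 2 arc := by
  refine (Lp.memLp f).congr_norm ?_ ?_
  · exact ((Lp.aestronglyMeasurable O).aemeasurable.div
      (Lp.aestronglyMeasurable a).aemeasurable).aestronglyMeasurable
  · filter_upwards [ha, h] with x h1 h2
    rw [norm_div, h2, norm_mul, mul_div_cancel_left₀ _ (norm_ne_zero_iff.2 h1)]

theorem exists_isFactorization {a b : Linf} (ha : ∀ᵐ x ∂arc, a x ≠ 0) (hb : ∀ᵐ x ∂arc, b x ≠ 0)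
    {f : L2} (hf : f ∈ (transposedPaired a b).ker) (h0 : f ≠ 0) :
    ∃ (Im : Linf) (Om Op : L2), IsFactorization a b Im Om Op := by
  rw [mem_ker_transposedPaired] at hf
  have hne : ∀ c : Linf, (∀ᵐ x ∂arc, c x ≠ 0) → mulOp c f ≠ 0 := fun c hc h => h0 <| by
    apply Lp.ext
    rw [Lp.ext_iff] at h
    filter_upwards [coeFn_mulOp c f, hc, h, Lp.coeFn_zero ℂ 2 arc] with x h1 h2 h3 h4
    rw [h1, h4] at h3
    rw [h4]
    exact (mul_eq_zero.1 h3).resolve_left h2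
  obtain ⟨J, Om, hJ, hOm, hm⟩ := exists_inner_outer_minus hf.1 (hne a ha)
  obtain ⟨I, Op, hI, hOp, hp⟩ := exists_inner_outer hf.2 (hne b hb)
  obtain ⟨ω, hω, hωe⟩ := exists_isInner_mul hJ hI
  have hma : ∀ᵐ x ∂arc, a x * f x = conj (J x) * Om x := by
    rw [Lp.ext_iff] at hm
    filter_upwards [hm, coeFn_mulOp a f, coeFn_mulOp (star J) Om, coeFn_star_ae J]
      with x h1 h2 h3 h4
    rw [← h2, h1, h3, h4]
  have hpa : ∀ᵐ x ∂arc, b x * f x = I x * Op x := by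
    rw [Lp.ext_iff] at hp
    filter_upwards [hp, coeFn_mulOp b f, coeFn_mulOp I Op] with x h1 h2 h3
    rw [← h2, h1, h3]
  refine ⟨star ω, Om, Op, by rwa [star_star], hOm, hOp, ?_, memLp_div_of_norm_eq ha (f := f) ?_,
    memLp_div_of_norm_eq hb (f := f) ?_⟩
  · filter_upwards [hma, hpa, hωe, coeFn_star_ae ω, hb, hI.2,
      ae_ne_zero_of_mem_H2plus hOp.1 (hOp.ne_zero)] with x h1 h2 h3 h4 h5 h6 h7
    have h8 : I x * conj (I x) = 1 := by rw [RCLike.mul_conj, h6]; simp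
    -- `bf = I O₊` with neither factor zero, so `f x` can be cancelled when the two factorisations
    -- are divided.
    have h9 : f x ≠ 0 := by
      intro h
      rw [h, mul_zero] at h2
      rcases mul_eq_zero.1 h2.symm with h | h
      · rw [h] at h6; simp at h6
      · exact h7 h
    rw [h4, h3, map_mul, ← div_eq_mul_inv, div_eq_div_iff h5 h7]
    apply mul_right_cancel₀ h9
    linear_combination Op x * h1 - conj (J x) * conj (I x) * Om x * h2 -
      conj (J x) * Om x * Op x * h8
  · filter_upwards [hma, hJ.2] with x h1 h2
    rw [h1, norm_mul, RCLike.norm_conj, h2, one_mul]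
  · filter_upwards [hpa, hI.2] with x h1 h2
    rw [h1, norm_mul, h2, one_mul]

theorem exists_mem_ker_of_isFactorization {a b Im : Linf} {Om Op : L2}
    (hb : ∀ᵐ x ∂arc, b x ≠ 0) (h : IsFactorization a b Im Om Op) :
    ∃ φ : L2, (φ =ᵐ[arc] fun x => Op x / b x) ∧ φ ∈ (transposedPaired a b).ker ∧ φ ≠ 0 := by
  obtain ⟨hI, hOm, hOp, hab, -, hL⟩ := h
  have hne := hOp.ne_zero
  have hφ := hL.coeFn_toLp
  set φ : L2 := hL.toLp with hφdef
  have hbφ : mulOp b φ = Op := by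
    apply Lp.ext
    filter_upwards [coeFn_mulOp b φ, hφ, hb] with x h1 h2 h3
    rw [h1, h2, mul_div_cancel₀ _ h3]
  -- The double star presents `I₋` as the conjugate of the inner function `star Im`, which preserves
  -- `H²₋`.
  have haφ : mulOp a φ = mulOp (star (star Im)) Om := by
    apply Lp.ext
    filter_upwards [coeFn_mulOp a φ, hφ, hab, ae_ne_zero_of_mem_H2plus hOp.1 hne,
      coeFn_mulOp (star (star Im)) Om, coeFn_star_ae (star Im), coeFn_star_ae Im]
      with x h1 h2 h3 h4 h5 h6 h7
    rw [h1, h2, h5, h6, h7, Complex.conj_conj, ← mul_div_assoc, mul_div_right_comm, h3,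
      inv_mul_cancel_right₀ h4]
  refine ⟨φ, hφ, mem_ker_transposedPaired.2 ⟨?_, ?_⟩, ?_⟩
  · rw [haφ]; exact mulOp_star_isInner_mem_H2minus hI hOm.1
  · rw [hbφ]; exact hOp.1
  · intro h0
    rw [h0, map_zero] at hbφ
    exact hne hbφ.symm

end PairedOp

theorem mainTheorem3 (a b : PairedOp.Linf)
    (ha : ∀ᵐ x ∂PairedOp.arc, a x ≠ 0) (hb : ∀ᵐ x ∂PairedOp.arc, b x ≠ 0) :
    ((PairedOp.transposedPaired a b).ker ≠ ⊥ ↔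
      ∃ (Im : PairedOp.Linf) (Om Op : PairedOp.L2), PairedOp.IsFactorization a b Im Om Op) ∧
    ∀ (Im : PairedOp.Linf) (Om Op : PairedOp.L2), PairedOp.IsFactorization a b Im Om Op →
      ∃ φ : PairedOp.L2, (φ =ᵐ[PairedOp.arc] fun x => Op x / b x) ∧
        φ ∈ (PairedOp.transposedPaired a b).ker ∧ φ ≠ 0 := by
  refine ⟨⟨fun h => ?_, ?_⟩, fun Im Om Op h => PairedOp.exists_mem_ker_of_isFactorization hb h⟩
  · obtain ⟨f, hf, h0⟩ := Submodule.exists_mem_ne_zero_of_ne_bot h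
    exact PairedOp.exists_isFactorization ha hb hf h0
  · rintro ⟨Im, Om, Op, h⟩
    obtain ⟨φ, -, h1, h2⟩ := PairedOp.exists_mem_ker_of_isFactorization hb h
    exact (Submodule.ne_bot_iff _).2 ⟨φ, h1, h2⟩
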